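/- For integers $m,n\ge 0$ let $D(m,n)$ be the direct (Cartesian) product of $m$ copies of the Shrikhande graph (the Cayley graph of $\mathbb{Z}_4^2$ with connecting set $\{01,03,10,30,11,33\}$) and $n$ copies of the complete graph $K_4$; it is called a Doob graph if $m>0$, and $D(0,n)$ is the Hamming graph $H(n,4)$. For a non-negative integer $c$, a nonempty set $C$ of vertices of $D(m,n)$ is called a $c$-fold $1$-perfect code if every ball of radius $1$ in $D(m,n)$ contains exactly $c$ vertices of $C$. Let $m,n,c\ge 0$ be integers with $c\ne 6m+3n+1$. (The value $c=6m+3n+1$ is the number of vertices in a ball of radius $1$, and for it the whole vertex set is, trivially, a $c$-fold $1$-perfect code in every $D(m,n)$.) Then a $c$-fold $1$-perfect code exists in $D(m,n)$ if and only if both of the following conditions hold: 1. $2m+n\equiv 1 \pmod 4$; 2. $c=\alpha l$, where $6m+3n+1=\alpha\cdot 2^k$ with $\alpha$ odd, and $l\in\{1,\ldots,2^k\}$. Moreover, if $2m+n\equiv 1\pmod 4$ and $6m+3n+1=\alpha\cdot 2^k$ with $\alpha$ odd, then the vertex set of $D(m,n)$ can be partitioned into $2^k$ pairwise disjoint $\alpha$-fold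 $1$-perfect codes. -/

import Mathlib

/-- The direct (Cartesian) product of a family of graphs: two vertices are adjacent if and only if
they are adjacent in one coordinate and agree in all the other coordinates. -/
def cartesianProd {ι V : Type*} (G : ι → SimpleGraph V) : SimpleGraph (ι → V) where
  Adj x y := ∃ i, (G i).Adj (x i) (y i) ∧ ∀ j, j ≠ i → x j = y j
  symm := ⟨fun _ _ ⟨i, h, h'⟩ => ⟨i, h.symm, fun j hj => (h' j hj).symm⟩⟩
  loopless := ⟨fun _ ⟨i, h, _⟩ => (G i).loopless.irrefl _ h⟩

/-- The Shrikhande graph: the Cayley graph of `ℤ₄ × ℤ₄` with connecting set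
`{01, 03, 10, 30, 11, 33}`. -/
def shrikhandeGraph : SimpleGraph (ZMod 4 × ZMod 4) :=
  SimpleGraph.circulantGraph {(0, 1), (0, 3), (1, 0), (3, 0), (1, 1), (3, 3)}

/-- The vertex set `(ℤ₄ × ℤ₄)ᵐ × ℤ₄ⁿ` of `D(m,n)`. -/
abbrev DoobVertex (m n : ℕ) : Type := (Fin m → ZMod 4 × ZMod 4) × (Fin n → ZMod 4)

/-- The graph `D(m,n)`: the direct (Cartesian) product of `m` copies of the Shrikhande graph and
`n` copies of the complete graph on `4` vertices. -/
def doobGraph (m n : ℕ) : SimpleGraph (DoobVertex m n) :=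
  (cartesianProd fun _ : Fin m => shrikhandeGraph).boxProd
    (cartesianProd fun _ : Fin n => (⊤ : SimpleGraph (ZMod 4)))

/-- The ball `B(x)` of radius `1` with center `x`. -/
def unitBall {V : Type*} (G : SimpleGraph V) (x : V) : Set V := {y | G.edist x y ≤ 1}

/-- `C` is a `μ`-fold `1`-perfect code in `G`: a nonempty set of vertices that contains exactly
`μ` vertices of every ball of radius `1`. -/
def IsMultifoldPerfectCode {V : Type*} (G : SimpleGraph V) (μ : ℕ) (C : Set V) : Prop :=
  C.Nonempty ∧ ∀ x : V, (C ∩ unitBall G x).encard = μ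

/-! Necessity. The degree of `D(m,n)` is `6m+3n`, so for a code `C` the function `(6m+3n+1)·1_C - c`
is an eigenfunction with eigenvalue `-1`, nonzero unless `c = 6m+3n+1`. Every eigenvalue is
congruent to `2m+3n` modulo 4 (`EigenvaluesModFour.doobGraph`), which forces `2m+n ≡ 1`. Double
counting gives `|C|(6m+3n+1) = c·2^(4m+2n)`, so the odd part `α` divides `c`.

Sufficiency. Unions of classes of a partition into `2^k` codes of multiplicity `α` give all the
other codes, so it is enough to colour the vertices so that each ball meets each of `2^k` colours
`α` times (`hasEquicolouring_doobGraph`). The exponent drops by two at a time: if `2m+n = 4d`, then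
`D(m,n)` covers `D(0,d)` fourfold, and a colouring of `D(0,d)` lifts to `D(m,n+1)` with four times
as many colours (`FourCovers.hasEquicolouring`). The recursion ends at `k = 0`, which is trivial, or
at `k = 3`, where the colours are the elements of `ℤ₂³` and the neighbours are counted by colour
difference. -/

open SimpleGraph

/-! ### Neighbour counts -/

/-- The number of neighbours of `x` that satisfy `p`. -/
noncomputable def nbrCount {V : Type*} (G : SimpleGraph V) (x : V) (p : V → Prop) : ℕ∞ :=
  {y | G.Adj x y ∧ p y}.encard

theorem nbrCount_congr {V : Type*} {G : SimpleGraph V} {x : V} {p q : V → Prop}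
    (h : ∀ y, p y ↔ q y) : nbrCount G x p = nbrCount G x q := by
  simp only [nbrCount, h]

theorem nbrCount_and_left {V : Type*} (G : SimpleGraph V) (x : V) (r : Prop) [Decidable r]
    (p : V → Prop) : nbrCount G x (fun y => r ∧ p y) = if r then nbrCount G x p else 0 := by
  split_ifs with h <;> simp [nbrCount, h]

theorem nbrCount_iso {V W : Type*} {G : SimpleGraph V} {H : SimpleGraph W} (e : G ≃g H) (x : V)
    (p : W → Prop) : nbrCount G x (fun y => p (e y)) = nbrCount H (e x) p := by
  unfold nbrCount
  rw [← e.injective.encard_image]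
  congr 1
  ext y
  constructor
  · rintro ⟨z, ⟨h, hp⟩, rfl⟩
    exact ⟨e.map_adj_iff.2 h, hp⟩
  · rintro ⟨h, hp⟩
    obtain ⟨z, rfl⟩ := e.surjective y
    exact ⟨z, ⟨e.map_adj_iff.1 h, hp⟩, rfl⟩

theorem nbrCount_boxProd {V W : Type*} (G : SimpleGraph V) (H : SimpleGraph W) (x : V × W)
    (p : V × W → Prop) :
    nbrCount (G □ H) x p =
      nbrCount G x.1 (fun y => p (y, x.2)) + nbrCount H x.2 (fun y => p (x.1, y)) := by
  unfold nbrCount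
  have h1 : Function.Injective fun y : V => (y, x.2) := fun a b h => congrArg Prod.fst h
  have h2 : Function.Injective fun y : W => (x.1, y) := fun a b h => congrArg Prod.snd h
  rw [← h1.encard_image, ← h2.encard_image, ← Set.encard_union_eq]
  · congr 1
    ext ⟨a, b⟩
    simp only [boxProd_adj, Set.mem_ofPred_eq, Set.mem_union, Set.mem_image, Prod.mk.injEq]
    constructor
    · rintro ⟨⟨h, hb⟩ | ⟨h, ha⟩, hp⟩
      · exact Or.inl ⟨a, ⟨h, hb ▸ hp⟩, rfl, hb⟩
      · exact Or.inr ⟨b, ⟨h, ha ▸ hp⟩, ha, rfl⟩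
    · rintro (⟨y, ⟨h, hp⟩, rfl, rfl⟩ | ⟨y, ⟨h, hp⟩, rfl, rfl⟩)
      · exact ⟨Or.inl ⟨h, rfl⟩, hp⟩
      · exact ⟨Or.inr ⟨h, rfl⟩, hp⟩
  · rw [Set.disjoint_left]
    rintro _ ⟨a, ⟨h, -⟩, rfl⟩ ⟨b, -, hb⟩
    exact G.ne_of_adj h (congrArg Prod.fst hb)

theorem nbrCount_eq_card {V : Type*} [Fintype V] (G : SimpleGraph V) [DecidableRel G.Adj] (x : V)
    (p : V → Prop) [DecidablePred p] :
    nbrCount G x p = (Finset.univ.filter fun y => G.Adj x y ∧ p y).card := by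
  unfold nbrCount
  rw [← Set.encard_coe_eq_coe_finsetCard]
  simp

/-- The connecting set of the Shrikhande graph. -/
def shrikhandeGens : Finset (ZMod 4 × ZMod 4) := {(0, 1), (0, 3), (1, 0), (3, 0), (1, 1), (3, 3)}

theorem shrikhandeGraph_adj (x y : ZMod 4 × ZMod 4) :
    shrikhandeGraph.Adj x y ↔ y - x ∈ shrikhandeGens := by
  have h : ∀ z : ZMod 4 × ZMod 4, ((z ≠ 0 ∧ (-z ∈ shrikhandeGens ∨ z ∈ shrikhandeGens)) ↔
    z ∈ shrikhandeGens) := by decide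
  rw [← h (y - x), neg_sub, sub_ne_zero]
  simp [shrikhandeGraph, circulantGraph, shrikhandeGens, ne_comm]

instance : DecidableRel shrikhandeGraph.Adj := fun x y =>
  decidable_of_iff _ (shrikhandeGraph_adj x y).symm

theorem nbrCount_shrikhandeGraph (x : ZMod 4 × ZMod 4) (p : ZMod 4 × ZMod 4 → Prop)
    [DecidablePred p] :
    nbrCount shrikhandeGraph x p = (shrikhandeGens.filter fun s => p (x + s)).card := by
  unfold nbrCount
  rw [← Set.encard_coe_eq_coe_finsetCard,
    ← (add_right_injective x).encard_image (shrikhandeGens.filter _ : Set _)]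
  congr 1
  ext y
  simp only [shrikhandeGraph_adj, Set.mem_ofPred_eq, Set.mem_image, Finset.mem_coe,
    Finset.mem_filter]
  constructor
  · rintro ⟨h, hp⟩
    exact ⟨y - x, ⟨h, by simpa using hp⟩, by simp⟩
  · rintro ⟨s, ⟨h, hp⟩, rfl⟩
    exact ⟨by simpa using h, hp⟩

theorem nbrCount_top {V : Type*} [Fintype V] [DecidableEq V] (x : V) (p : V → Prop)
    [DecidablePred p] :
    nbrCount (⊤ : SimpleGraph V) x p = (Finset.univ.filter fun y => x ≠ y ∧ p y).card := by
  rw [nbrCount_eq_card]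
  simp

/-! ### Decompositions of Doob graphs as box products -/

section Iso

variable {ι κ V W : Type*}

/-- Splitting the index set splits a Cartesian product of copies of a graph. -/
def cartesianProdSumIso (G : SimpleGraph V) :
    (cartesianProd fun _ : ι ⊕ κ => G) ≃g
      (cartesianProd fun _ : ι => G) □ (cartesianProd fun _ : κ => G) where
  toEquiv := Equiv.sumArrowEquivProdArrow ι κ V
  map_rel_iff' := by
    intro x y
    simp only [boxProd_adj, cartesianProd, Equiv.sumArrowEquivProdArrow, Equiv.coe_fn_mk,
      funext_iff, Function.comp_apply, Sum.exists, Sum.forall]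
    simp only [ne_eq, Sum.inl.injEq, reduceCtorEq, not_false_eq_true, forall_const, Sum.inr.injEq]
    constructor
    · rintro (⟨⟨i, h, h'⟩, h''⟩ | ⟨⟨i, h, h'⟩, h''⟩)
      · exact Or.inl ⟨i, h, h', h''⟩
      · exact Or.inr ⟨i, h, h'', h'⟩
    · rintro (⟨i, h, h', h''⟩ | ⟨i, h, h', h''⟩)
      · exact Or.inl ⟨⟨i, h, h'⟩, h''⟩
      · exact Or.inr ⟨⟨i, h, h''⟩, h'⟩

/-- Reindexing a Cartesian product of copies of a graph. -/
def cartesianProdCongr (G : SimpleGraph V) (e : ι ≃ κ) :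
    (cartesianProd fun _ : ι => G) ≃g (cartesianProd fun _ : κ => G) where
  toEquiv := e.arrowCongr (Equiv.refl V)
  map_rel_iff' := by
    intro x y
    simp only [cartesianProd, Equiv.arrowCongr_apply, Equiv.coe_refl, Function.comp_apply, id_eq]
    rw [e.exists_congr_left]
    refine exists_congr fun i => and_congr_right fun _ => ?_
    rw [e.forall_congr_left]
    simp

/-- The box product of isomorphic graphs. -/
def boxProdCongr {V' W' : Type*} {G : SimpleGraph V} {G' : SimpleGraph V'} {H : SimpleGraph W}
    {H' : SimpleGraph W'} (e : G ≃g G') (f : H ≃g H') : (G □ H) ≃g (G' □ H') where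
  toEquiv := e.toEquiv.prodCongr f.toEquiv
  map_rel_iff' := by
    intro x y
    have he : ∀ a b, G'.Adj (e a) (e b) ↔ G.Adj a b := fun a b => e.map_adj_iff
    have hf : ∀ a b, H'.Adj (f a) (f b) ↔ H.Adj a b := fun a b => f.map_adj_iff
    simp [boxProd_adj, he, hf]

/-- The middle four exchange for box products. -/
def boxProdBoxProdComm {V' W' : Type*} (G : SimpleGraph V) (G' : SimpleGraph V')
    (H : SimpleGraph W) (H' : SimpleGraph W') :
    ((G □ G') □ (H □ H')) ≃g ((G □ H) □ (G' □ H')) where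
  toEquiv := Equiv.prodProdProdComm _ _ _ _
  map_rel_iff' := by
    rintro ⟨⟨a, b⟩, c, d⟩ ⟨⟨a', b'⟩, c', d'⟩
    simp only [boxProd_adj, Equiv.prodProdProdComm_apply, Prod.mk.injEq]
    tauto

end Iso

/-- `D(m + m', n + n')` is the box product of `D(m, n)` and `D(m', n')`. -/
def doobGraphAddIso (m m' n n' : ℕ) :
    doobGraph (m + m') (n + n') ≃g (doobGraph m n □ doobGraph m' n') :=
  (boxProdCongr ((cartesianProdCongr _ finSumFinEquiv.symm).trans (cartesianProdSumIso _))
    ((cartesianProdCongr _ finSumFinEquiv.symm).trans (cartesianProdSumIso _))).trans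
      (boxProdBoxProdComm _ _ _ _)

/-- `D(1, 0)` is the Shrikhande graph. -/
def doobGraphOneZeroIso : doobGraph 1 0 ≃g shrikhandeGraph where
  toEquiv := (Equiv.prodUnique _ _).trans (Equiv.funUnique (Fin 1) _)
  map_rel_iff' := by
    intro x y
    simp [doobGraph, boxProd_adj, cartesianProd, Unique.forall_iff, Unique.exists_iff]
    exact fun _ => Subsingleton.elim _ _

/-- `D(0, 1)` is the complete graph on four vertices. -/
def doobGraphZeroOneIso : doobGraph 0 1 ≃g (⊤ : SimpleGraph (ZMod 4)) where
  toEquiv := (Equiv.uniqueProd _ _).trans (Equiv.funUnique (Fin 1) _)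
  map_rel_iff' := by
    intro x y
    simp [doobGraph, boxProd_adj, cartesianProd, Unique.forall_iff, Unique.exists_iff]
    exact fun _ => Subsingleton.elim _ _

/-! ### Translation colourings -/

/-- Some map `f` to the additive group `A` is such that every vertex `x` has exactly `c a`
neighbours `y` with `f y - f x = a`, for every `a`. -/
def HasTranslationColouring {V A : Type*} [AddCommGroup A] (G : SimpleGraph V) (c : A → ℕ) :
    Prop :=
  ∃ f : V → A, ∀ x q, nbrCount G x (fun y => f y = q) = c (q - f x)

namespace HasTranslationColouring

variable {V W A : Type*} [AddCommGroup A] {G : SimpleGraph V} {H : SimpleGraph W} {c d : A → ℕ}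

theorem of_iso (e : G ≃g H) (h : HasTranslationColouring H c) : HasTranslationColouring G c := by
  obtain ⟨f, hf⟩ := h
  exact ⟨fun x => f (e x), fun x q => (nbrCount_iso e x fun y => f y = q).trans (hf _ _)⟩

/-- Add the two colourings: a move in one factor changes the sum by the same difference as in that
factor alone. -/
theorem boxProd (hG : HasTranslationColouring G c) (hH : HasTranslationColouring H d) :
    HasTranslationColouring (G □ H) (c + d) := by
  obtain ⟨f, hf⟩ := hG
  obtain ⟨g, hg⟩ := hH
  refine ⟨fun x => f x.1 + g x.2, fun x q => ?_⟩
  rw [nbrCount_boxProd, nbrCount_congr (q := fun y => f y = q - g x.2) fun y =>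
      eq_sub_iff_add_eq.symm,
    nbrCount_congr (G := H) (q := fun y => g y = q - f x.1) fun y => eq_sub_iff_add_eq'.symm,
    hf, hg]
  simp [sub_sub, add_comm]

theorem doobGraph_add {m m' n n' : ℕ} (h : HasTranslationColouring (doobGraph m n) c)
    (h' : HasTranslationColouring (doobGraph m' n') d) :
    HasTranslationColouring (doobGraph (m + m') (n + n')) (c + d) :=
  (h.boxProd h').of_iso (doobGraphAddIso m m' n n')

theorem doobGraph_zero_zero : HasTranslationColouring (doobGraph 0 0) (0 : A → ℕ) := by
  refine ⟨fun _ => 0, fun x q => ?_⟩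
  simp only [nbrCount, Pi.zero_apply, Nat.cast_zero, Set.encard_eq_zero]
  refine Set.eq_empty_of_forall_notMem fun y hy => hy.1.ne (Subsingleton.elim _ _)

theorem doobGraph_one_zero [DecidableEq A] (f : ZMod 4 × ZMod 4 → A)
    (hf : ∀ x q, (shrikhandeGens.filter fun s => f (x + s) = q).card = c (q - f x)) :
    HasTranslationColouring (doobGraph 1 0) c :=
  of_iso doobGraphOneZeroIso
    ⟨f, fun x q => by rw [nbrCount_shrikhandeGraph, hf]⟩

theorem doobGraph_zero_one [DecidableEq A] (f : ZMod 4 → A)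
    (hf : ∀ x q, (Finset.univ.filter fun y => x ≠ y ∧ f y = q).card = c (q - f x)) :
    HasTranslationColouring (doobGraph 0 1) c :=
  of_iso doobGraphZeroOneIso ⟨f, fun x q => by rw [nbrCount_top, hf]⟩

end HasTranslationColouring

theorem hasTranslationColouring_doobGraph_degree (m n : ℕ) :
    HasTranslationColouring (doobGraph m n) (fun _ : Unit => 6 * m + 3 * n) := by
  have h1 : HasTranslationColouring (doobGraph 1 0) (fun _ : Unit => 6) :=
    .doobGraph_one_zero (fun _ => ()) (by decide)
  have h2 : HasTranslationColouring (doobGraph 0 1) (fun _ : Unit => 3) :=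
    .doobGraph_zero_one (fun _ => ()) (by decide)
  induction m with
  | zero =>
    induction n with
    | zero => exact .doobGraph_zero_zero
    | succ n ih =>
      have := ih.doobGraph_add h2
      rwa [show ((fun _ => 6 * 0 + 3 * n) + fun _ => 3 : Unit → ℕ) = fun _ => 6 * 0 + 3 * (n + 1)
        from funext fun _ => by simp; ring] at this
  | succ m ih =>
    have := ih.doobGraph_add h1
    rwa [show ((fun _ => 6 * m + 3 * n) + fun _ => 6 : Unit → ℕ) = fun _ => 6 * (m + 1) + 3 * n
      from funext fun _ => by simp; ring] at this

/-- `D(m, n)` is regular of degree `6 m + 3 n`. -/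
theorem nbrCount_doobGraph_true (m n : ℕ) (x : DoobVertex m n) :
    nbrCount (doobGraph m n) x (fun _ => True) = (6 * m + 3 * n : ℕ) := by
  obtain ⟨f, hf⟩ := hasTranslationColouring_doobGraph_degree m n
  rw [← hf x (f x)]
  exact nbrCount_congr fun y => by simp

/-! ### Fourfold covers of Hamming graphs -/

/-- `G` covers `H` fourfold: for a map `u` to `H` and a labelling `v`, the neighbours of a vertex
`x` correspond to the pairs of a neighbour of `u x` and a label. -/
def FourCovers {V W : Type*} (G : SimpleGraph V) (H : SimpleGraph W) : Prop :=
  ∃ (u : V → W) (v : V → ZMod 4), ∀ x h q,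
    (H.Adj (u x) h → nbrCount G x (fun y => u y = h ∧ v y = q) = 1) ∧
    (¬ H.Adj (u x) h → nbrCount G x (fun y => u y = h ∧ v y = q) = 0)

namespace FourCovers

variable {V V' W W' : Type*} {G : SimpleGraph V} {H : SimpleGraph W} {G' : SimpleGraph V'}
  {H' : SimpleGraph W'}

theorem of_iso_left (e : G ≃g G') (h : FourCovers G' H) : FourCovers G H := by
  obtain ⟨u, v, h⟩ := h
  refine ⟨fun x => u (e x), fun x => v (e x), fun x t q => ?_⟩
  rw [nbrCount_iso e x fun y => u y = t ∧ v y = q]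
  exact h _ _ _

theorem of_iso_right (e : H ≃g H') (h : FourCovers G H) : FourCovers G H' := by
  obtain ⟨u, v, h⟩ := h
  refine ⟨fun x => e (u x), v, fun x t q => ?_⟩
  obtain ⟨t, rfl⟩ := e.surjective t
  simpa [e.map_adj_iff] using h x t q

/-- Pair the projections and add the labels: a move in one factor only shifts the label by the
constant label of the other. -/
theorem boxProd (h : FourCovers G H) (h' : FourCovers G' H') : FourCovers (G □ G') (H □ H') := by
  classical
  obtain ⟨u, v, h⟩ := h
  obtain ⟨u', v', h'⟩ := h'
  refine ⟨fun x => (u x.1, u' x.2), fun x => v x.1 + v' x.2, ?_⟩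
  rintro ⟨x, x'⟩ ⟨t, t'⟩ q
  rw [nbrCount_boxProd]
  dsimp only
  have e1 : nbrCount G x (fun y => (u y, u' x') = (t, t') ∧ v y + v' x' = q) =
      if u' x' = t' then nbrCount G x (fun y => u y = t ∧ v y = q - v' x') else 0 := by
    rw [← nbrCount_and_left]
    refine nbrCount_congr fun y => ?_
    rw [Prod.mk.injEq, eq_sub_iff_add_eq]
    tauto
  have e2 : nbrCount G' x' (fun y => (u x, u' y) = (t, t') ∧ v x + v' y = q) =
      if u x = t then nbrCount G' x' (fun y => u' y = t' ∧ v' y = q - v x) else 0 := by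
    rw [← nbrCount_and_left]
    refine nbrCount_congr fun y => ?_
    rw [Prod.mk.injEq, eq_sub_iff_add_eq']
    tauto
  rw [e1, e2, boxProd_adj]
  have k := h x t (q - v' x')
  have k' := h' x' t' (q - v x)
  dsimp only
  by_cases a : u' x' = t' <;> by_cases b : u x = t
  · subst a b
    simp [k.2 (H.irrefl), k'.2 (H'.irrefl)]
  · simpa [a, b] using k
  · simpa [a, b] using k'
  · simp [a, b]

theorem doobGraph_add {m m' n n' d d' : ℕ} (h : FourCovers (doobGraph m n) (doobGraph 0 d))
    (h' : FourCovers (doobGraph m' n') (doobGraph 0 d')) :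
    FourCovers (doobGraph (m + m') (n + n')) (doobGraph 0 (d + d')) :=
  ((h.boxProd h').of_iso_left (doobGraphAddIso m m' n n')).of_iso_right
    (doobGraphAddIso 0 0 d d').symm

theorem doobGraph_zero_zero : FourCovers (doobGraph 0 0) (doobGraph 0 0) := by
  refine ⟨id, fun _ => 0, fun x t q => ⟨fun h => (h.ne (Subsingleton.elim _ _)).elim, fun _ => ?_⟩⟩
  simp only [nbrCount, Set.encard_eq_zero]
  exact Set.eq_empty_of_forall_notMem fun y hy => hy.1.ne (Subsingleton.elim _ _)

/-- When each colour in another class of `(β ·).1` occurs once around a vertex and those in its own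
class never, the class is the projection to `K₄` and the position inside the class is the label. -/
theorem of_translationColouring {A : Type*} [AddCommGroup A] {c : A → ℕ}
    (h : HasTranslationColouring G c) (β : A ≃ ZMod 4 × ZMod 4)
    (hβ : ∀ a b, c (b - a) = if (β a).1 = (β b).1 then 0 else 1) :
    FourCovers G (doobGraph 0 1) := by
  refine of_iso_right doobGraphZeroOneIso.symm ?_
  obtain ⟨f, hf⟩ := h
  refine ⟨fun x => (β (f x)).1, fun x => (β (f x)).2, fun x t q => ?_⟩
  have : nbrCount G x (fun y => (β (f y)).1 = t ∧ (β (f y)).2 = q) =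
      if (β (f x)).1 = t then 0 else 1 := by
    rw [nbrCount_congr (q := fun y => f y = β.symm (t, q)), hf, hβ]
    · simp
    · intro y
      rw [Equiv.eq_symm_apply, Prod.ext_iff]
  rw [this, top_adj]
  by_cases h : (β (f x)).1 = t <;> simp [h]

end FourCovers

/-- The differences of the three factors (six, three and three) partition the complement of `{0} ×
ℤ₄` in `ℤ₄²`. -/
theorem fourCovers_doobGraph_one_two : FourCovers (doobGraph 1 2) (doobGraph 0 1) := by
  have h1 : HasTranslationColouring (doobGraph 1 0) (fun q : ZMod 4 × ZMod 4 =>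
      (shrikhandeGens.filter fun s => (s.1 + s.2, 2 * s.2 - s.1) = q).card) :=
    .doobGraph_one_zero (fun x => (x.1 + x.2, 2 * x.2 - x.1)) (by decide +kernel)
  have h2 : HasTranslationColouring (doobGraph 0 1) (fun q : ZMod 4 × ZMod 4 =>
      if q.1 = q.2 ∧ q.1 ≠ 0 then 1 else 0) :=
    .doobGraph_zero_one (fun y => (y, y)) (by decide +kernel)
  have h3 : HasTranslationColouring (doobGraph 0 1) (fun q : ZMod 4 × ZMod 4 =>
      if q.2 = 0 ∧ q.1 ≠ 0 then 1 else 0) :=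
    .doobGraph_zero_one (fun y => (y, 0)) (by decide +kernel)
  exact .of_translationColouring (h1.doobGraph_add (h2.doobGraph_add h3)) (Equiv.refl _)
    (by decide +kernel)

/-- The bijection that sends a pair of elements of `ℤ₄` to the pair of its residue modulo two and
its quotient. -/
def residueQuotientEquiv : ZMod 4 × ZMod 4 ≃ ZMod 4 × ZMod 4 where
  toFun x := ((x.1.val % 2 + 2 * (x.2.val % 2) : ℕ), (x.1.val / 2 + 2 * (x.2.val / 2) : ℕ))
  invFun x := ((x.1.val % 2 + 2 * (x.2.val % 2) : ℕ), (x.1.val / 2 + 2 * (x.2.val / 2) : ℕ))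
  left_inv := by decide +kernel
  right_inv := by decide +kernel

/-- The Shrikhande connecting set and its image under a linear map partition `ℤ₄² \ 2ℤ₄²`; the
classes are the residues modulo 2. -/
theorem fourCovers_doobGraph_two_zero : FourCovers (doobGraph 2 0) (doobGraph 0 1) := by
  have h1 : HasTranslationColouring (doobGraph 1 0) (fun q : ZMod 4 × ZMod 4 =>
      if q ∈ shrikhandeGens then 1 else 0) :=
    .doobGraph_one_zero id (by decide +kernel)
  have h2 : HasTranslationColouring (doobGraph 1 0) (fun q : ZMod 4 × ZMod 4 =>
      (shrikhandeGens.filter fun s => (s.1 + 2 * s.2, 2 * s.1 - s.2) = q).card) :=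
    .doobGraph_one_zero (fun x => (x.1 + 2 * x.2, 2 * x.1 - x.2)) (by decide +kernel)
  exact .of_translationColouring (h1.doobGraph_add h2) residueQuotientEquiv (by decide +kernel)

/-- The map from `ℤ₄` to `ℤ₂²` that takes `0, 1, 2, 3` to `0, p, q, p + q`. -/
def lineMap {A : Type*} [AddCommGroup A] (p q : A) (y : ZMod 4) : A :=
  (y.val % 2) • p + (y.val / 2) • q

/-- The bijection between `ℤ₂²` and `ℤ₄` given by the binary expansion. -/
def binaryEquiv : ZMod 2 × ZMod 2 ≃ ZMod 4 where
  toFun x := (x.1.val + 2 * x.2.val : ℕ)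
  invFun := lineMap (1, 0) (0, 1)
  left_inv := by decide +kernel
  right_inv := by decide +kernel

/-- A spread of `𝔽₄²`: the four `K₄` factors take the lines `y = λx`, `λ ∈ 𝔽₄`, whose nonzero points
partition the complement of `x = 0`. Here `p` and `q` are the images of the basis `1, ω` under
multiplication by `λ`. -/
theorem fourCovers_doobGraph_zero_four : FourCovers (doobGraph 0 4) (doobGraph 0 1) := by
  have h (p q : ZMod 2 × ZMod 2)
      (hpq : (p = (0, 0) ∧ q = (0, 0)) ∨ (p = (1, 0) ∧ q = (0, 1)) ∨ (p = (0, 1) ∧ q = (1, 1)) ∨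
        (p = (1, 1) ∧ q = (1, 0))) :
      HasTranslationColouring (doobGraph 0 1) (fun t : (ZMod 2 × ZMod 2) × (ZMod 2 × ZMod 2) =>
        if t.1 ≠ 0 ∧ t.2 = t.1.1.val • p + t.1.2.val • q then 1 else 0) := by
    refine .doobGraph_zero_one (lineMap ((1, 0), p) ((0, 1), q)) ?_
    obtain ⟨rfl, rfl⟩ | ⟨rfl, rfl⟩ | ⟨rfl, rfl⟩ | ⟨rfl, rfl⟩ := hpq <;> decide +kernel
  have h0 := h (0, 0) (0, 0) (by simp)
  have h1 := h (1, 0) (0, 1) (by simp)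
  have h2 := h (0, 1) (1, 1) (by simp)
  have h3 := h (1, 1) (1, 0) (by simp)
  exact .of_translationColouring (h0.doobGraph_add (h1.doobGraph_add (h2.doobGraph_add h3)))
    (binaryEquiv.prodCongr binaryEquiv) (by decide +kernel)

/-- If `2 m + n = 4 d`, then `D(m, n)` is a fourfold cover of the Hamming graph `D(0, d)`. -/
theorem fourCovers_doobGraph (d : ℕ) :
    ∀ m n : ℕ, 2 * m + n = 4 * d → FourCovers (doobGraph m n) (doobGraph 0 d) := by
  induction d with
  | zero =>
    intro m n h
    obtain ⟨rfl, rfl⟩ : m = 0 ∧ n = 0 := by omega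
    exact .doobGraph_zero_zero
  | succ d ih =>
    intro m n h
    obtain hm | rfl | rfl : 2 ≤ m ∨ m = 1 ∨ m = 0 := by omega
    · obtain ⟨m, rfl⟩ := Nat.exists_eq_add_of_le' hm
      exact (ih m n (by omega)).doobGraph_add fourCovers_doobGraph_two_zero
    · obtain ⟨n, rfl⟩ := Nat.exists_eq_add_of_le' (show 2 ≤ n by omega)
      exact (zero_add 1) ▸ (ih 0 n (by omega)).doobGraph_add fourCovers_doobGraph_one_two
    · obtain ⟨n, rfl⟩ := Nat.exists_eq_add_of_le' (show 4 ≤ n by omega)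
      exact (ih 0 n (by omega)).doobGraph_add fourCovers_doobGraph_zero_four

/-! ### Equicolourings and their lifts -/

/-- The vertices of `G` are coloured with `N` colours in such a way that every ball of radius `1`
contains exactly `α` vertices of every colour. -/
def HasEquicolouring {V : Type*} (G : SimpleGraph V) (N α : ℕ) : Prop :=
  ∃ T : V → Fin N, ∀ x q, (nbrCount G x (fun y => T y = q) + if T x = q then 1 else 0) = α

theorem HasEquicolouring.of_fintype {V Q : Type*} [Fintype Q] [DecidableEq Q] {G : SimpleGraph V}
    {N α : ℕ} (hN : Fintype.card Q = N) (T : V → Q)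
    (hT : ∀ x q, (nbrCount G x (fun y => T y = q) + if T x = q then 1 else 0) = α) :
    HasEquicolouring G N α := by
  let e := Fintype.equivFinOfCardEq hN
  refine ⟨fun x => e (T x), fun x q => ?_⟩
  simpa [Equiv.eq_symm_apply] using hT x (e.symm q)

theorem HasEquicolouring.of_iso {V W : Type*} {G : SimpleGraph V} {H : SimpleGraph W} {N α : ℕ}
    (e : G ≃g H) (h : HasEquicolouring H N α) : HasEquicolouring G N α := by
  obtain ⟨T, hT⟩ := h
  refine ⟨fun x => T (e x), fun x q => ?_⟩
  rw [nbrCount_iso e x fun y => T y = q, hT]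

/-- Colour `(x, z)` by `(T (u x), v x + z)`. Neighbours along `G` reproduce, for each label, the
count over the neighbours of `u x`; the centre and its `K₄`-neighbours take every label once,
playing the part of the centre `u x`. -/
theorem FourCovers.hasEquicolouring {V W : Type*} {G : SimpleGraph V} {H : SimpleGraph W}
    {N α : ℕ} (h : FourCovers G H) (hH : HasEquicolouring H N α) :
    HasEquicolouring (G □ (⊤ : SimpleGraph (ZMod 4))) (N * 4) α := by
  classical
  obtain ⟨u, v, h⟩ := h
  obtain ⟨T, hT⟩ := hH
  have key (x : V) (t : Fin N) (q : ZMod 4) :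
      nbrCount G x (fun y => T (u y) = t ∧ v y = q) = nbrCount H (u x) (fun y => T y = t) := by
    unfold nbrCount
    rw [← Set.InjOn.encard_image (f := u) (s := {y | G.Adj x y ∧ T (u y) = t ∧ v y = q})]
    · congr 1
      ext y
      constructor
      · rintro ⟨y, ⟨h1, h2, h3⟩, rfl⟩
        refine ⟨?_, h2⟩
        by_contra hn
        have := (h x (u y) q).2 hn
        rw [nbrCount, Set.encard_eq_zero] at this
        exact Set.eq_empty_iff_forall_notMem.1 this y ⟨h1, rfl, h3⟩
      · rintro ⟨h1, h2⟩
        have := (h x y q).1 h1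
        rw [nbrCount, Set.encard_eq_one] at this
        obtain ⟨z, hz⟩ := this
        have hz' : z ∈ ({z} : Set V) := rfl
        rw [← hz] at hz'
        obtain ⟨a, rfl, b⟩ := hz'
        exact ⟨z, ⟨a, h2, b⟩, rfl⟩
    · rintro y ⟨h1, -, h3⟩ z ⟨h1', -, h3'⟩ hyz
      have : nbrCount G x (fun w => u w = u y ∧ v w = q) ≤ 1 := by
        by_cases k : H.Adj (u x) (u y)
        · exact ((h x (u y) q).1 k).le
        · simp [(h x (u y) q).2 k]
      exact Set.encard_le_one_iff.1 this y z ⟨h1, rfl, h3⟩ ⟨h1', hyz.symm, h3'⟩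
  refine .of_fintype (Q := Fin N × ZMod 4) (by simp) (fun x => (T (u x.1), v x.1 + x.2)) ?_
  rintro ⟨x, z⟩ ⟨t, q⟩
  rw [nbrCount_boxProd]
  dsimp only
  rw [nbrCount_congr (q := fun y => T (u y) = t ∧ v y = q - z) fun y => by
      rw [Prod.mk.injEq, eq_sub_iff_add_eq], key,
    nbrCount_congr (q := fun y => T (u x) = t ∧ y = q - v x) fun y => by
      rw [Prod.mk.injEq, eq_sub_iff_add_eq'], nbrCount_and_left, ← hT (u x) t, add_assoc]
  congr 1
  have e : nbrCount (⊤ : SimpleGraph (ZMod 4)) z (fun y => y = q - v x) =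
      if v x + z = q then 0 else 1 := by
    unfold nbrCount
    by_cases hz : v x + z = q
    · rw [if_pos hz, Set.encard_eq_zero]
      refine Set.eq_empty_of_forall_notMem ?_
      rintro y ⟨h1, rfl⟩
      exact h1 (eq_sub_of_add_eq' hz)
    · rw [if_neg hz, Set.encard_eq_one]
      refine ⟨q - v x, Set.ext fun y => ⟨fun h => h.2, ?_⟩⟩
      rintro rfl
      exact ⟨fun h => hz (by rw [h]; abel), rfl⟩
  rw [e]
  by_cases a : T (u x) = t <;> by_cases b : v x + z = q <;> simp [a, b]

theorem HasTranslationColouring.hasEquicolouring {V A : Type*} [AddCommGroup A] [Fintype A]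
    [DecidableEq A] {G : SimpleGraph V} {c : A → ℕ} {α : ℕ} (h : HasTranslationColouring G c)
    (hc : ∀ a, (c a + if a = 0 then 1 else 0) = α) : HasEquicolouring G (Fintype.card A) α := by
  obtain ⟨f, hf⟩ := h
  refine .of_fintype rfl f fun x q => ?_
  rw [hf, ← hc (q - f x)]
  simp [sub_eq_zero, eq_comm]

/-! ### Eight colours from `ℤ₂³` -/

/-- `lineCount p q a` is the number of times that `a` occurs among `p`, `q`, `p + q`. -/
def lineCount {A : Type*} [AddCommGroup A] [DecidableEq A] (p q a : A) : ℕ :=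
  (if a = p then 1 else 0) + (if a = q then 1 else 0) + (if a = p + q then 1 else 0)

/-- The group `ℤ₂³`. -/
abbrev ElemEight : Type := ZMod 2 × ZMod 2 × ZMod 2

theorem hasTranslationColouring_lineCount (p q : ElemEight) :
    HasTranslationColouring (doobGraph 0 1) (lineCount p q) :=
  .doobGraph_zero_one (lineMap p q) (by revert p q; decide +kernel)

/-- Every `D(m, n)` with `2 m + n = 2 r` has a translation colouring with counting function `c`. -/
def IsDoobRealizable {A : Type*} [AddCommGroup A] (r : ℕ) (c : A → ℕ) : Prop :=
  ∀ m n, 2 * m + n = 2 * r → HasTranslationColouring (doobGraph m n) c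

namespace IsDoobRealizable

variable {A : Type*} [AddCommGroup A] {r s : ℕ} {c d : A → ℕ}

theorem zero : IsDoobRealizable 0 (0 : A → ℕ) := by
  intro m n h
  obtain ⟨rfl, rfl⟩ : m = 0 ∧ n = 0 := by omega
  exact .doobGraph_zero_zero

theorem add (hc : IsDoobRealizable r c) (hd : IsDoobRealizable s d) :
    IsDoobRealizable (r + s) (c + d) := by
  intro m n h
  obtain hm | hm := le_total m r
  · obtain ⟨k, rfl⟩ := Nat.exists_eq_add_of_le (show 2 * r - 2 * m ≤ n by omega)
    exact (hc m (2 * r - 2 * m) (by omega)).doobGraph_add (hd 0 k (by omega))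
  · obtain ⟨k, rfl⟩ := Nat.exists_eq_add_of_le hm
    exact zero_add n ▸ (hc r 0 rfl).doobGraph_add (hd k n (by omega))

theorem nsmul (hc : IsDoobRealizable r c) (t : ℕ) : IsDoobRealizable (t * r) (t • c) := by
  induction t with
  | zero => simpa using zero
  | succ t ih => rw [add_smul, one_smul, add_mul, one_mul]; exact ih.add hc

theorem one (h1 : HasTranslationColouring (doobGraph 1 0) c)
    (h2 : HasTranslationColouring (doobGraph 0 2) c) : IsDoobRealizable 1 c := by
  intro m n h
  obtain ⟨rfl, rfl⟩ | ⟨rfl, rfl⟩ : (m = 1 ∧ n = 0) ∨ (m = 0 ∧ n = 2) := by omega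
  · exact h1
  · exact h2

end IsDoobRealizable

/-- On the Shrikhande graph, reduction modulo 2 is a homomorphism that hits each of `p`, `q`, `p +
q` with two generators; two copies of `K₄` use the same line twice. -/
theorem isDoobRealizable_lineCount_add_self (p q : ElemEight) :
    IsDoobRealizable 1 (lineCount p q + lineCount p q) := by
  refine .one (.doobGraph_one_zero (fun x => x.1.val • p + x.2.val • q) ?_)
    ((hasTranslationColouring_lineCount p q).doobGraph_add (hasTranslationColouring_lineCount p q))
  have hadd : ∀ (a b : ZMod 4) (p : ElemEight), (a + b).val • p = a.val • p + b.val • p := by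
    decide +kernel
  have hcount : ∀ p q r : ElemEight, (shrikhandeGens.filter fun s =>
      s.1.val • p + s.2.val • q = r).card = lineCount p q r + lineCount p q r := by
    decide +kernel
  intro x r
  rw [Pi.add_apply, ← hcount]
  congr 1
  refine Finset.filter_congr fun s _ => ?_
  rw [Prod.fst_add, Prod.snd_add, hadd, hadd, eq_sub_iff_add_eq, add_add_add_comm,
    add_comm]

theorem isDoobRealizable_lineCount_zero_add :
    IsDoobRealizable 1 (lineCount (0 : ElemEight) 0 + lineCount (1, 0, 0) 0) :=
  .one (.doobGraph_one_zero (fun x => (x.1.val / 2) • (1, 0, 0)) (by decide +kernel))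
    ((hasTranslationColouring_lineCount _ _).doobGraph_add (hasTranslationColouring_lineCount _ _))

/-- A step `±1` in `x.1` flips exactly one of the two halved terms, and the opposite step flips the
other, so two distinct lines through a point come from one Shrikhande graph. -/
theorem isDoobRealizable_lineCount_add :
    IsDoobRealizable 1 (lineCount (1, 0, 0) ((0, 1, 0) : ElemEight) +
      lineCount (1, 0, 0) (0, 0, 1)) :=
  .one (.doobGraph_one_zero (fun x => (x.2.val • (1, 0, 0) + (x.1.val / 2) • (0, 1, 0) +
      ((x.1 + 1).val / 2) • (0, 0, 1))) (by decide +kernel))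
    ((hasTranslationColouring_lineCount _ _).doobGraph_add (hasTranslationColouring_lineCount _ _))

/-- The seven lines of the Fano plane and the degenerate line `0, 0, 0`, each doubled: every point
is on three lines. -/
theorem isDoobRealizable_const_six : IsDoobRealizable 8 (fun _ : ElemEight => 6) := by
  have h := fun p q => isDoobRealizable_lineCount_add_self p q
  have := (h 0 0).add <| (h (0, 0, 1) (0, 1, 0)).add <| (h (0, 0, 1) (1, 0, 0)).add <|
    (h (0, 0, 1) (1, 1, 0)).add <| (h (0, 1, 0) (1, 0, 0)).add <| (h (0, 1, 0) (1, 0, 1)).add <|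
    (h (1, 0, 0) (0, 1, 1)).add (h (0, 1, 1) (1, 0, 1))
  convert this using 1
  decide +kernel

theorem hasEquicolouring_doobGraph_eight {m n t : ℕ} (h : 2 * m + n = 16 * t + 13) :
    HasEquicolouring (doobGraph m n) 8 (6 * t + 5) := by
  obtain ⟨n, rfl⟩ : ∃ k, n = k + 1 := ⟨n - 1, by omega⟩
  -- Every nonzero difference must occur 5 times and `0` must occur 4 times. Doubled lines give only
  -- even counts; the last mixed pair together with the single line of the extra `K₄` makes all
  -- seven nonzero counts odd.
  have h2 := fun p q => isDoobRealizable_lineCount_add_self p q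
  have := (h2 (0, 1, 0) (0, 0, 1)).add <| (h2 (0, 1, 0) (1, 0, 1)).add <|
    (h2 (1, 1, 0) (0, 0, 1)).add <| (h2 (1, 1, 0) (1, 0, 1)).add <|
    isDoobRealizable_lineCount_zero_add.add isDoobRealizable_lineCount_add
  have key := (((isDoobRealizable_const_six.nsmul t).add this) m n (by omega)).doobGraph_add
    (hasTranslationColouring_lineCount (1, 0, 0) (0, 1, 1))
  refine key.hasEquicolouring (α := 6 * t + 5) fun a => ?_
  have base : ∀ a : ElemEight, (lineCount (0, 1, 0) (0, 0, 1) a + lineCount (0, 1, 0) (0, 0, 1) a +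
      (lineCount (0, 1, 0) (1, 0, 1) a + lineCount (0, 1, 0) (1, 0, 1) a +
      (lineCount (1, 1, 0) (0, 0, 1) a + lineCount (1, 1, 0) (0, 0, 1) a +
      (lineCount (1, 1, 0) (1, 0, 1) a + lineCount (1, 1, 0) (1, 0, 1) a +
      (lineCount 0 0 a + lineCount (1, 0, 0) 0 a +
      (lineCount (1, 0, 0) (0, 1, 0) a + lineCount (1, 0, 0) (0, 0, 1) a)))))) +
      lineCount (1, 0, 0) (0, 1, 1) a + (if a = 0 then 1 else 0) = 5 := by
    decide +kernel
  simp only [Pi.add_apply, Pi.smul_apply, smul_eq_mul]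
  rw [← base a]
  ring

/-! ### The recursion on the exponent -/

/-- If `6 m + 3 n + 1 = α 2 ^ k` with `α` odd and `k ≠ 1`, then the vertices of `D(m, n)` have a
colouring with `2 ^ k` colours such that every ball contains exactly `α` vertices of every
colour. -/
theorem hasEquicolouring_doobGraph {α : ℕ} (hα : Odd α) (k : ℕ) (hk : k ≠ 1) :
    ∀ m n, 6 * m + 3 * n + 1 = α * 2 ^ k → HasEquicolouring (doobGraph m n) (2 ^ k) α := by
  induction k using Nat.strong_induction_on with
  | _ k ih =>
    intro m n h
    -- The case `k = 3` is separate because lowering it by two gives the excluded exponent 1.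
    obtain rfl | rfl | ⟨k, rfl, hk'⟩ : k = 0 ∨ k = 3 ∨ ∃ j, k = j + 2 ∧ j ≠ 1 := by
      rcases k with _ | _ | k
      · simp
      · simp at hk
      · by_cases k = 1 <;> simp_all
    · refine ⟨fun _ => 0, fun x q => ?_⟩
      have : q = 0 := Fin.ext (by have := q.isLt; simp only [pow_zero] at this; omega)
      subst this
      simp only [nbrCount_doobGraph_true, if_true]
      rw [← Nat.cast_one, ← Nat.cast_add, h]
      simp
    · obtain ⟨a, rfl⟩ := hα
      obtain ⟨t, rfl⟩ : ∃ t, a = 3 * t + 2 := ⟨(a - 2) / 3, by omega⟩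
      have := hasEquicolouring_doobGraph_eight (m := m) (n := n) (t := t) (by omega)
      rwa [show 6 * t + 5 = 2 * (3 * t + 2) + 1 by ring] at this
    · rw [pow_add] at h ⊢
      obtain ⟨N, hN⟩ : ∃ N, α * 2 ^ k = N := ⟨_, rfl⟩
      rw [← mul_assoc, hN] at h
      obtain ⟨d, rfl⟩ : ∃ d, N = 3 * d + 1 := ⟨(N - 1) / 3, by omega⟩
      obtain ⟨n, rfl⟩ : ∃ j, n = j + 1 := ⟨n - 1, by omega⟩
      have h1 := ih k (by omega) hk' 0 d (by omega)
      exact ((fourCovers_doobGraph d m n (by omega)).hasEquicolouring h1).of_iso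
        ((doobGraphAddIso m 0 n 1).trans (boxProdCongr (Iso.refl) doobGraphZeroOneIso))

/-! ### From colourings to codes -/

theorem encard_inter_unitBall {V : Type*} (G : SimpleGraph V) (x : V) (C : Set V)
    [Decidable (x ∈ C)] :
    (C ∩ unitBall G x).encard = nbrCount G x (fun y => y ∈ C) + if x ∈ C then 1 else 0 := by
  unfold nbrCount
  split_ifs with h
  · have : C ∩ unitBall G x = insert x {y | G.Adj x y ∧ y ∈ C} := by
      ext y
      simp only [unitBall, Set.mem_inter_iff, Set.mem_ofPred_eq, edist_le_one_iff_adj_or_eq,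
        Set.mem_insert_iff]
      constructor
      · rintro ⟨a, b | rfl⟩
        · exact Or.inr ⟨b, a⟩
        · exact Or.inl rfl
      · rintro (rfl | ⟨a, b⟩)
        · exact ⟨h, Or.inr rfl⟩
        · exact ⟨b, Or.inl a⟩
    rw [this, Set.encard_insert_of_notMem fun hx => hx.1.ne rfl]
  · rw [add_zero]
    congr 1
    ext y
    simp only [unitBall, Set.mem_inter_iff, Set.mem_ofPred_eq, edist_le_one_iff_adj_or_eq]
    constructor
    · rintro ⟨a, b | rfl⟩
      · exact ⟨b, a⟩
      · exact absurd a h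
    · rintro ⟨a, b⟩
      exact ⟨b, Or.inl a⟩

/-- The colour classes of an equitable colouring are multifold perfect codes. -/
theorem HasEquicolouring.exists_partition {V : Type*} [Nonempty V] {G : SimpleGraph V} {N α : ℕ}
    (h : HasEquicolouring G N α) (hα : α ≠ 0) :
    ∃ C : Fin N → Set V, (∀ i, IsMultifoldPerfectCode G α (C i)) ∧
      (∀ i j, i ≠ j → Disjoint (C i) (C j)) ∧ (⋃ i, C i) = Set.univ := by
  classical
  obtain ⟨T, hT⟩ := h
  have hball : ∀ i x, ({y | T y = i} ∩ unitBall G x).encard = α := by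
    intro i x
    rw [encard_inter_unitBall]
    exact hT x i
  refine ⟨fun i => {y | T y = i}, fun i => ⟨?_, hball i⟩, fun i j hij => ?_, ?_⟩
  · obtain ⟨x⟩ := ‹Nonempty V›
    have : ({y | T y = i} ∩ unitBall G x).Nonempty := by
      rw [← Set.encard_ne_zero, hball]
      exact_mod_cast hα
    exact this.mono Set.inter_subset_left
  · rw [Set.disjoint_left]
    rintro x rfl h
    exact hij h
  · ext x
    simp

/-- The union of disjoint multifold perfect codes is a multifold perfect code. -/
theorem IsMultifoldPerfectCode.biUnion {V ι : Type*} {G : SimpleGraph V} {α : ℕ} {C : ι → Set V}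
    (h : ∀ i, IsMultifoldPerfectCode G α (C i)) (hC : ∀ i j, i ≠ j → Disjoint (C i) (C j))
    {s : Finset ι} (hs : s.Nonempty) :
    IsMultifoldPerfectCode G (α * s.card) (⋃ i ∈ s, C i) := by
  classical
  constructor
  · obtain ⟨i, hi⟩ := hs
    exact (h i).1.mono (Set.subset_biUnion_of_mem hi)
  · intro x
    clear hs
    induction s using Finset.induction_on with
    | empty => simp
    | insert a s ha ih =>
      rw [Finset.set_biUnion_insert, Set.union_inter_distrib_right, Set.encard_union_eq, ih,
        (h a).2, Finset.card_insert_of_notMem ha]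
      · push_cast; ring
      · refine Set.disjoint_left.2 fun y hy hy' => ?_
        obtain ⟨i, hi, hyi⟩ := Set.mem_iUnion₂.1 hy'.1
        exact Set.disjoint_left.1 (hC a i fun e => ha (e ▸ hi)) hy.1 hyi

/-! ### Eigenvalues modulo four -/

open Classical in
/-- The adjacency operator of a finite graph. -/
noncomputable def adjOp {V : Type*} [Fintype V] (G : SimpleGraph V) : (V → ℂ) →ₗ[ℂ] (V → ℂ) where
  toFun g x := ∑ y with G.Adj x y, g y
  map_add' g h := by ext; simp [Finset.sum_add_distrib]
  map_smul' a g := by ext; simp [Finset.mul_sum]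

/-- All eigenvalues of the graph `G` are integers congruent to `r` modulo four. -/
def EigenvaluesModFour {V : Type*} [Fintype V] (G : SimpleGraph V) (r : ℤ) : Prop :=
  ∀ (a : ℂ) (g : V → ℂ), g ≠ 0 → adjOp G g = a • g → ∃ z : ℤ, a = (r + 4 * z : ℤ)

open Classical in
theorem adjOp_apply {V : Type*} [Fintype V] (G : SimpleGraph V) (g : V → ℂ) (x : V) :
    adjOp G g x = ∑ y with G.Adj x y, g y := rfl

namespace EigenvaluesModFour

variable {V W : Type*} [Fintype V] [Fintype W] {G : SimpleGraph V} {H : SimpleGraph W} {r s : ℤ}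

theorem of_iso (e : G ≃g H) (h : EigenvaluesModFour H r) : EigenvaluesModFour G r := by
  classical
  intro a g hg hag
  refine h a (fun y => g (e.symm y)) (fun h0 => hg ?_) (funext fun y => ?_)
  · ext x
    simpa using congrFun h0 (e x)
  · have := congrFun hag (e.symm y)
    rw [adjOp_apply] at this ⊢
    rw [Pi.smul_apply] at this ⊢
    rw [← this]
    refine Finset.sum_equiv e.symm.toEquiv (fun z => ?_) fun z _ => rfl
    rw [Finset.mem_filter_univ, Finset.mem_filter_univ]
    exact e.symm.map_adj_iff.symm

/-- The adjacency operators of the two directions commute, so an eigenspace of their sum contains a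
common eigenvector; its restrictions to a row and a column are eigenfunctions of the factors. -/
theorem boxProd (hG : EigenvaluesModFour G r) (hH : EigenvaluesModFour H s) :
    EigenvaluesModFour (G □ H) (r + s) := by
  classical
  intro a g hg hag
  let S : (V × W → ℂ) →ₗ[ℂ] (V × W → ℂ) :=
    { toFun g x := adjOp G (fun y => g (y, x.2)) x.1
      map_add' g h := by ext; simp [adjOp_apply, Finset.sum_add_distrib]
      map_smul' a g := by ext; simp [adjOp_apply, Finset.mul_sum] }
  let T : (V × W → ℂ) →ₗ[ℂ] (V × W → ℂ) :=
    { toFun g x := adjOp H (fun y => g (x.1, y)) x.2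
      map_add' g h := by ext; simp [adjOp_apply, Finset.sum_add_distrib]
      map_smul' a g := by ext; simp [adjOp_apply, Finset.mul_sum] }
  have hS : ∀ g x, S g x = ∑ y with G.Adj x.1 y, g (y, x.2) := fun _ _ => rfl
  have hT : ∀ g x, T g x = ∑ y with H.Adj x.2 y, g (x.1, y) := fun _ _ => rfl
  have hST : adjOp (G □ H) = S + T := by
    refine LinearMap.ext fun g => funext fun x => ?_
    have : Finset.univ.filter (fun y => (G □ H).Adj x y) =
        (Finset.univ.filter fun y => G.Adj x.1 y) ×ˢ {x.2} ∪
          {x.1} ×ˢ (Finset.univ.filter fun y => H.Adj x.2 y) := by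
      ext y
      simp only [boxProd_adj, Finset.mem_filter, Finset.mem_univ, true_and, Finset.mem_union,
        Finset.mem_product, Finset.mem_singleton]
      tauto
    rw [adjOp_apply, this, Finset.sum_union, Finset.sum_product, Finset.sum_product]
    · simp [hS, hT]
    · rw [Finset.disjoint_left]
      rintro y hy hy'
      simp only [Finset.mem_filter, Finset.mem_univ, true_and, Finset.mem_product,
        Finset.mem_singleton] at hy hy'
      exact hy.1.ne hy'.1.symm
  have hcomm : Commute S T := by
    refine LinearMap.ext fun g => funext fun x => ?_
    simp only [Module.End.mul_apply, hS, hT]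
    exact Finset.sum_comm
  have hmaps : Set.MapsTo S (Module.End.eigenspace (S + T) a) (Module.End.eigenspace (S + T) a) := by
    intro k hk
    have hk' := Module.End.mem_eigenspace_iff.1 hk
    refine Module.End.mem_eigenspace_iff.2 ?_
    rw [← map_smul, ← hk', ← Module.End.mul_apply, ← Module.End.mul_apply, mul_add, add_mul,
      hcomm.eq]
  have hne : Nontrivial (Module.End.eigenspace (S + T) a) := by
    rw [Submodule.nontrivial_iff_ne_bot, Submodule.ne_bot_iff]
    exact ⟨g, Module.End.mem_eigenspace_iff.2 (hST ▸ hag), hg⟩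
  obtain ⟨b, hb⟩ := Module.End.exists_eigenvalue (S.restrict hmaps)
  obtain ⟨⟨k, hk⟩, hk1, hk0⟩ := hb.exists_hasEigenvector
  have hkS : S k = b • k := congrArg Subtype.val (Module.End.mem_eigenspace_iff.1 hk1)
  have hkT : T k = (a - b) • k := by
    rw [Module.End.mem_eigenspace_iff, LinearMap.add_apply, hkS] at hk
    rw [sub_smul, ← hk, add_sub_cancel_left]
  obtain ⟨⟨x, y⟩, hxy⟩ := Function.ne_iff.1 (show k ≠ 0 from fun h => hk0 (Subtype.ext h))
  obtain ⟨z, hz⟩ := hG b (fun x => k (x, y)) (fun h => hxy (congrFun h x))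
    (funext fun x => congrFun hkS (x, y))
  obtain ⟨w, hw⟩ := hH (a - b) (fun y => k (x, y)) (fun h => hxy (congrFun h y))
    (funext fun y => congrFun hkT (x, y))
  refine ⟨z + w, ?_⟩
  rw [← sub_add_cancel a b, hw, hz]
  push_cast
  ring

theorem top_zmod_four : EigenvaluesModFour (⊤ : SimpleGraph (ZMod 4)) 3 := by
  classical
  intro a g hg hag
  have key : ∀ x, ∑ y, g y = (a + 1) * g x := by
    intro x
    have := congrFun hag x
    rw [adjOp_apply, Pi.smul_apply, smul_eq_mul] at this
    rw [add_mul, ← this, one_mul, ← Finset.sum_filter_add_sum_filter_not _ fun y => x ≠ y]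
    simp [Finset.sum_filter]
  by_cases h : ∑ y, g y = 0
  · obtain ⟨x, hx⟩ : ∃ x, g x ≠ 0 := Function.ne_iff.1 hg
    have := key x
    rw [h, eq_comm, mul_eq_zero, or_iff_left hx] at this
    exact ⟨-1, by rw [eq_neg_of_add_eq_zero_left this]; norm_num⟩
  · have := Finset.sum_congr (rfl : Finset.univ = Finset.univ) fun x _ => key x
    rw [← Finset.mul_sum, Finset.sum_const, Finset.card_univ, ZMod.card, nsmul_eq_mul] at this
    have := mul_right_cancel₀ h this
    exact ⟨0, by linear_combination -this⟩

/-- Strong regularity, `A² = 4I + 2J`, leaves only the eigenvalues `6` and `±2`. -/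
theorem shrikhandeGraph : EigenvaluesModFour shrikhandeGraph 2 := by
  classical
  intro a g hg hag
  have hA : ∀ x, ∑ s ∈ shrikhandeGens, g (x + s) = a * g x := by
    intro x
    have := congrFun hag x
    rw [adjOp_apply, Pi.smul_apply, smul_eq_mul] at this
    rw [← this]
    refine Finset.sum_bij' (fun s _ => x + s) (fun y _ => y - x) ?_ ?_ ?_ ?_ ?_ <;>
      simp [shrikhandeGraph_adj]
  have key : ∀ x, 2 * ∑ y, g y = (a ^ 2 - 4) * g x := by
    intro x
    have h1 : ∑ p ∈ shrikhandeGens ×ˢ shrikhandeGens, g (x + (p.1 + p.2)) = a ^ 2 * g x := by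
      rw [Finset.sum_product]
      simp only [← add_assoc, hA, ← Finset.mul_sum]
      ring
    have h2 : ∀ d : ZMod 4 × ZMod 4, ((shrikhandeGens ×ˢ shrikhandeGens).filter
        fun p => p.1 + p.2 = d).card = 2 + if d = 0 then 4 else 0 := by
      decide +kernel
    have h3 : ∑ d, g (x + d) = ∑ y, g y := Equiv.sum_comp (Equiv.addLeft x) g
    rw [← Finset.sum_fiberwise _ (fun p => p.1 + p.2)] at h1
    have h4 : ∀ d : ZMod 4 × ZMod 4, ∑ p ∈ (shrikhandeGens ×ˢ shrikhandeGens).filter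
        (fun p => p.1 + p.2 = d), g (x + (p.1 + p.2)) =
          2 * g (x + d) + if d = 0 then 4 * g x else 0 := by
      intro d
      rw [Finset.sum_congr rfl (g := fun _ => g (x + d)) fun p hp => by
        rw [(Finset.mem_filter.1 hp).2], Finset.sum_const, h2, nsmul_eq_mul]
      split_ifs with h
      · subst h
        push_cast
        rw [add_zero]; ring
      · simp
    simp only [h4] at h1
    rw [Finset.sum_add_distrib, ← Finset.mul_sum, h3] at h1
    simp only [Finset.sum_ite_eq', Finset.mem_univ, if_true] at h1
    linear_combination h1
  by_cases h : ∑ y, g y = 0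
  · obtain ⟨x, hx⟩ : ∃ x, g x ≠ 0 := Function.ne_iff.1 hg
    have := key x
    rw [h, mul_zero, eq_comm, mul_eq_zero, or_iff_left hx] at this
    have : (a - 2) * (a + 2) = 0 := by linear_combination this
    obtain h | h := mul_eq_zero.1 this
    · exact ⟨0, by linear_combination h⟩
    · exact ⟨-1, by push_cast; linear_combination h⟩
  · have hs : ∀ s, ∑ x, g (x + s) = ∑ y, g y := fun s => Equiv.sum_comp (Equiv.addRight s) g
    have hsum : a * ∑ y, g y = 6 * ∑ y, g y := by
      rw [Finset.mul_sum, Finset.sum_congr rfl fun x _ => (hA x).symm, Finset.sum_comm,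
        Finset.sum_congr rfl fun s _ => hs s,
        Finset.sum_const, show shrikhandeGens.card = 6 by decide]
      simp
    exact ⟨1, by rw [mul_right_cancel₀ h hsum]; norm_num⟩

theorem doobGraph (m n : ℕ) : EigenvaluesModFour (doobGraph m n) (2 * m + 3 * n) := by
  induction m with
  | zero =>
    induction n with
    | zero =>
      classical
      intro a g hg hag
      obtain ⟨x, hx⟩ : ∃ x, g x ≠ 0 := Function.ne_iff.1 hg
      have := congrFun hag x
      rw [adjOp_apply, Finset.sum_eq_zero, eq_comm, Pi.smul_apply, smul_eq_mul, mul_eq_zero,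
        or_iff_left hx] at this
      · exact ⟨0, by simpa using this⟩
      · intro y hy
        exact ((Finset.mem_filter_univ _).1 hy).ne (Subsingleton.elim _ _) |>.elim
    | succ n ih =>
      have := (ih.boxProd (top_zmod_four.of_iso doobGraphZeroOneIso)).of_iso
        (doobGraphAddIso 0 0 n 1)
      rwa [show (2 * ((0 : ℕ) : ℤ) + 3 * (n : ℤ) + 3) = 2 * (0 : ℕ) + 3 * (n + 1 : ℕ) by
        push_cast; ring] at this
  | succ m ih =>
    have := (ih.boxProd (shrikhandeGraph.of_iso doobGraphOneZeroIso)).of_iso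
      (doobGraphAddIso m 1 n 0)
    rwa [show (2 * (m : ℤ) + 3 * (n : ℤ) + 2) = 2 * (m + 1 : ℕ) + 3 * n by
      push_cast; ring] at this

end EigenvaluesModFour

/-! ### Necessary conditions on a code -/

section Necessity

variable {m n c : ℕ} {C : Set (DoobVertex m n)}

open Classical in
theorem IsMultifoldPerfectCode.card_filter_add (h : IsMultifoldPerfectCode (doobGraph m n) c C)
    (x : DoobVertex m n) :
    (Finset.univ.filter fun y => (doobGraph m n).Adj x y ∧ y ∈ C).card +
      (if x ∈ C then 1 else 0) = c := by
  have := h.2 x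
  rw [encard_inter_unitBall, nbrCount_eq_card] at this
  exact_mod_cast this

open Classical in
theorem card_filter_doobGraph_adj (x : DoobVertex m n) :
    (Finset.univ.filter fun y => (doobGraph m n).Adj x y).card = 6 * m + 3 * n := by
  have := nbrCount_doobGraph_true m n x
  rw [nbrCount_eq_card] at this
  simpa only [and_true, Nat.cast_inj] using this

theorem IsMultifoldPerfectCode.le (h : IsMultifoldPerfectCode (doobGraph m n) c C) :
    c ≤ 6 * m + 3 * n + 1 := by
  classical
  obtain ⟨x, -⟩ := h.1
  rw [← h.card_filter_add x, ← card_filter_doobGraph_adj x]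
  gcongr
  · intro hy
    exact hy.1
  · split_ifs <;> simp

theorem IsMultifoldPerfectCode.pos (h : IsMultifoldPerfectCode (doobGraph m n) c C) : 0 < c := by
  classical
  obtain ⟨x, hx⟩ := h.1
  rw [← h.card_filter_add x, if_pos hx]
  omega

/-- The double counting of the pairs of a code vertex and a ball that contains it. -/
theorem IsMultifoldPerfectCode.exists_card_mul (h : IsMultifoldPerfectCode (doobGraph m n) c C) :
    ∃ N : ℕ, N * (6 * m + 3 * n + 1) = c * 2 ^ (4 * m + 2 * n) := by
  classical
  refine ⟨(Finset.univ.filter fun x => x ∈ C).card, ?_⟩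
  have h1 := Finset.sum_congr (rfl : Finset.univ = Finset.univ) fun x _ => h.card_filter_add x
  have h2 : ∀ x, (Finset.univ.filter fun y => (doobGraph m n).Adj x y ∧ y ∈ C).card =
      ∑ y with y ∈ C, if (doobGraph m n).Adj x y then 1 else 0 := by
    intro x
    rw [Finset.sum_boole, Finset.filter_filter]
    simp only [and_comm, Nat.cast_id]
  have h3 : ∀ y, (∑ x, if (doobGraph m n).Adj x y then 1 else 0) = 6 * m + 3 * n := by
    intro y
    rw [Finset.sum_boole, ← card_filter_doobGraph_adj y]
    simp only [adj_comm, Nat.cast_id]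
  have h4 : Fintype.card (DoobVertex m n) = 2 ^ (4 * m + 2 * n) := by
    simp only [DoobVertex, Fintype.card_prod, Fintype.card_fun, ZMod.card, Fintype.card_fin]
    rw [pow_add, pow_mul, pow_mul]
    norm_num
  rw [Finset.sum_add_distrib, Finset.sum_congr rfl fun x _ => h2 x, Finset.sum_comm,
    Finset.sum_congr rfl fun y _ => h3 y, Finset.sum_boole, Finset.sum_const, Finset.sum_const,
    Finset.card_univ, h4] at h1
  simp only [smul_eq_mul, Nat.cast_id] at h1
  rw [mul_add, mul_one, h1, mul_comm]

theorem IsMultifoldPerfectCode.modEq (h : IsMultifoldPerfectCode (doobGraph m n) c C)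
    (hc : c ≠ 6 * m + 3 * n + 1) : 2 * m + n ≡ 1 [MOD 4] := by
  classical
  let g : DoobVertex m n → ℂ := fun x => (6 * m + 3 * n + 1) * (if x ∈ C then 1 else 0) - c
  have hg : g ≠ 0 := by
    obtain ⟨x, hx⟩ := h.1
    refine Function.ne_iff.2 ⟨x, fun h0 => hc ?_⟩
    simp only [g, if_pos hx, mul_one, Pi.zero_apply, sub_eq_zero] at h0
    exact_mod_cast h0.symm
  obtain ⟨z, hz⟩ := EigenvaluesModFour.doobGraph m n (-1) g hg (funext fun x => by
    have h1 := congrArg (Nat.cast (R := ℂ)) (h.card_filter_add x)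
    have h2 := congrArg (Nat.cast (R := ℂ)) (card_filter_doobGraph_adj x)
    rw [adjOp_apply, Finset.sum_sub_distrib, ← Finset.mul_sum, Finset.sum_boole,
      Finset.filter_filter, Finset.sum_const, nsmul_eq_mul, h2]
    simp only [g, Pi.smul_apply, smul_eq_mul]
    push_cast at h1 ⊢
    linear_combination (6 * m + 3 * n + 1 : ℂ) * h1)
  have hz' : (-1 : ℤ) = 2 * m + 3 * n + 4 * z := by exact_mod_cast hz
  unfold Nat.ModEq
  omega

end Necessity

theorem theoremt (m n : ℕ) :
    (∀ c : ℕ, c ≠ 6 * m + 3 * n + 1 →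
      ((∃ C : Set (DoobVertex m n), IsMultifoldPerfectCode (doobGraph m n) c C) ↔
        2 * m + n ≡ 1 [MOD 4] ∧
        ∃ α k l : ℕ, 6 * m + 3 * n + 1 = α * 2 ^ k ∧ Odd α ∧ 1 ≤ l ∧ l ≤ 2 ^ k ∧ c = α * l)) ∧
    (2 * m + n ≡ 1 [MOD 4] →
      ∀ α k : ℕ, 6 * m + 3 * n + 1 = α * 2 ^ k → Odd α →
        ∃ C : Fin (2 ^ k) → Set (DoobVertex m n),
          (∀ i, IsMultifoldPerfectCode (doobGraph m n) α (C i)) ∧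
          (∀ i j, i ≠ j → Disjoint (C i) (C j)) ∧
          (⋃ i, C i) = Set.univ) := by
  have partition : 2 * m + n ≡ 1 [MOD 4] →
      ∀ α k : ℕ, 6 * m + 3 * n + 1 = α * 2 ^ k → Odd α →
        ∃ C : Fin (2 ^ k) → Set (DoobVertex m n),
          (∀ i, IsMultifoldPerfectCode (doobGraph m n) α (C i)) ∧
          (∀ i j, i ≠ j → Disjoint (C i) (C j)) ∧
          (⋃ i, C i) = Set.univ := by
    intro h α k hN hα
    refine (hasEquicolouring_doobGraph hα k ?_ m n hN).exists_partition hα.pos.ne'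
    -- `2m+n ≡ 1 (mod 4)` makes `6m+3n+1` divisible by 4, so `k = 1` is impossible.
    rintro rfl
    obtain ⟨a, rfl⟩ := hα
    unfold Nat.ModEq at h
    omega
  refine ⟨fun c hc => ⟨?_, ?_⟩, partition⟩
  · rintro ⟨C, hC⟩
    obtain ⟨k, α, hα, hN⟩ := Nat.exists_eq_two_pow_mul_odd (n := 6 * m + 3 * n + 1) (by omega)
    rw [mul_comm _ α] at hN
    obtain ⟨N, hN'⟩ := hC.exists_card_mul
    have hdvd : α ∣ c := by
      refine (Nat.Coprime.pow_right (4 * m + 2 * n) hα.coprime_two_right).dvd_of_dvd_mul_right ?_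
      rw [← hN', hN]
      exact Dvd.intro (N * 2 ^ k) (by ring)
    obtain ⟨l, rfl⟩ := hdvd
    refine ⟨hC.modEq hc, α, k, l, hN, hα, Nat.pos_of_mul_pos_left hC.pos, ?_, rfl⟩
    exact Nat.le_of_mul_le_mul_left (hN ▸ hC.le) hα.pos
  · rintro ⟨h, α, k, l, hN, hα, hl, hlk, rfl⟩
    obtain ⟨C, hC, hdisj, -⟩ := partition h α k hN hα
    obtain ⟨s, -, hs⟩ := Finset.exists_subset_card_eq (s := (Finset.univ : Finset (Fin (2 ^ k))))
      (n := l) (by simpa using hlk)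
    exact ⟨_, hs ▸ IsMultifoldPerfectCode.biUnion hC hdisj (Finset.card_pos.1 (by omega))⟩
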